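/- Let $k$ be a field. A simplicial complex $\Delta$ on a finite vertex set is a collection of subsets (faces) closed under taking subsets; the empty set is a face. For a set $W$ of vertices of $\Delta$, the induced subcomplex $\Delta[W]$ consists of all faces of $\Delta$ contained in $W$. Define $$\operatorname{reg}(\Delta)=\max\{\,l+2 : \tilde H_l(\Delta[W];k)\neq 0 \text{ for some set } W \text{ of vertices of } \Delta\,\},$$ where $\tilde H_l(-;k)$, $l\ge -1$, is reduced simplicial homology with coefficients in $k$ (and $\tilde H_{-1}(\{\emptyset\};k)=k$). For a graph $H$, let $H^c$ be its complement and $\mathrm{cl}(H)$ its clique complex, whose faces are the cliques of $H$, including $\emptyset$. **Theorem.** Let $G$ be a finite simple graph, let $ab$ be an edge of $G$, and let $G'$ be the graph on the same vertex set obtained from $G$ by adding all edges $xy$ with $x\neq y$ and $ax,\,by\in E(G)$. Put $\Delta=\mathrm{cl}(G^c)$ and $\Delta'=\mathrm{cl}(G'^c)$. Then $$\operatorname{reg}(\Delta')\le \operatorname{reg}(\Delta).$$ -/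

import Mathlib

/-! Simplicial complexes are modelled by Mathlib's `PreAbstractSimplicialComplex V`, which records
the nonempty faces; the empty set is counted as a face of every complex wherever it matters
(it spans the chains of degree `-1` below). -/

namespace SimplicialReg

/-- The clique complex `cl(G)`: its faces are the cliques of `G`. -/
def cliqueComplex {V : Type*} (G : SimpleGraph V) : PreAbstractSimplicialComplex V where
  faces := {s | s.Nonempty ∧ G.IsClique (s : Set V)}
  isRelLowerSet_faces := fun _ hs =>
    ⟨hs.1, fun _ hts ht => ⟨ht, hs.2.subset (Finset.coe_subset.mpr hts)⟩⟩

/-- The vertex set of a complex. -/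
def vertices {V : Type*} (K : PreAbstractSimplicialComplex V) : Set V :=
  {v | {v} ∈ K.faces}

/-- The induced subcomplex `K[W]`: the faces of `K` contained in `W`. -/
def induced {V : Type*} (K : PreAbstractSimplicialComplex V) (W : Set V) :
    PreAbstractSimplicialComplex V where
  faces := {s | s ∈ K.faces ∧ (s : Set V) ⊆ W}
  isRelLowerSet_faces := fun _ hs =>
    ⟨(K.isRelLowerSet_faces hs.1).1, fun _ hts ht =>
      ⟨(K.isRelLowerSet_faces hs.1).2 hts ht, (Finset.coe_subset.mpr hts).trans hs.2⟩⟩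

/-- The quotient `Z / (Z ∩ B)` of submodules of a common module. -/
abbrev Subquotient {R M : Type*} [Ring R] [AddCommGroup M] [Module R M] (Z B : Submodule R M) :
    Type _ :=
  Z ⧸ B.submoduleOf Z

theorem nontrivial_subquotient_iff {R M : Type*} [Ring R] [AddCommGroup M] [Module R M]
    (Z B : Submodule R M) : Nontrivial (Subquotient Z B) ↔ ¬ Z ≤ B := by
  rw [Submodule.Quotient.nontrivial_iff, Ne, Submodule.submoduleOf_eq_top]

section Homology

variable (k : Type*) [Field k] {V : Type*} [LinearOrder V]

/-- The incidence sign of `v` in `s`: `(-1)^(r-1)` if `v` is the `r`-th element of `s`. The linear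
order on the vertices serves only to orient the simplices. -/
def sign (s : Finset V) (v : V) : k :=
  (-1) ^ (s.filter (· < v)).card

/-- The simplicial boundary `∂ e_s = ∑_{v ∈ s} sign(v, s) e_{s \ v}`, on the free module spanned
by all finite sets of vertices. It includes the augmentation `∂ e_{v} = e_∅`, and `∂ e_∅ = 0`. -/
noncomputable def boundary : (Finset V →₀ k) →ₗ[k] (Finset V →₀ k) :=
  Finsupp.linearCombination k fun s : Finset V =>
    ∑ v ∈ s, sign k s v • Finsupp.single (s.erase v) (1 : k)

/-- The reduced chains of degree `l`: the span of the faces of dimension `l`, that is, with `l + 1`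
elements, where the empty face spans degree `-1`. -/
noncomputable def chains (K : PreAbstractSimplicialComplex V) (l : ℤ) :
    Submodule k (Finset V →₀ k) :=
  Finsupp.supported k k {s | (s = ∅ ∨ s ∈ K.faces) ∧ (s.card : ℤ) = l + 1}

/-- The reduced `l`-cycles. -/
noncomputable def cycles (K : PreAbstractSimplicialComplex V) (l : ℤ) :
    Submodule k (Finset V →₀ k) :=
  chains k K l ⊓ LinearMap.ker (boundary k)

/-- The reduced `l`-boundaries. -/
noncomputable def boundaries (K : PreAbstractSimplicialComplex V) (l : ℤ) :
    Submodule k (Finset V →₀ k) :=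
  (chains k K (l + 1)).map (boundary k)

theorem boundary_single (s : Finset V) : boundary k (Finsupp.single s 1) =
    ∑ v ∈ s, sign k s v • Finsupp.single (s.erase v) (1 : k) := by
  simp [boundary]

theorem sign_cancel (s : Finset V) {v w : V} (hw : w ∈ s) (hwv : w < v) :
    sign k s v * sign k (s.erase v) w + sign k s w * sign k (s.erase w) v = 0 := by
  have h1 : (s.erase v).filter (· < w) = s.filter (· < w) := by
    ext u
    simp only [Finset.mem_filter, Finset.mem_erase]
    constructor
    · rintro ⟨⟨-, h⟩, h'⟩
      exact ⟨h, h'⟩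
    · rintro ⟨h, h'⟩
      exact ⟨⟨(h'.trans hwv).ne, h⟩, h'⟩
  have h2 : (s.filter (· < v)).card = ((s.erase w).filter (· < v)).card + 1 := by
    rw [Finset.filter_erase, Finset.card_erase_add_one]
    simp [hw, hwv]
  simp only [sign, h1, h2, pow_succ]
  ring

theorem boundary_boundary (x : Finset V →₀ k) : boundary k (boundary k x) = 0 := by
  induction x using Finsupp.induction_linear with
  | zero => simp
  | add x y hx hy => simp [hx, hy]
  | single s c =>
    have hc : (Finsupp.single s c : Finset V →₀ k) = c • Finsupp.single s 1 := by simp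
    rw [hc, map_smul, map_smul, boundary_single, map_sum]
    simp only [map_smul, boundary_single, Finset.smul_sum, smul_smul]
    suffices h : ∑ v ∈ s, ∑ w ∈ s.erase v, (sign k s v * sign k (s.erase v) w) •
        (Finsupp.single ((s.erase v).erase w) (1 : k) : Finset V →₀ k) = 0 by
      simp only [mul_smul, ← Finset.smul_sum] at h ⊢
      rw [h, smul_zero]
    rw [Finset.sum_sigma']
    refine Finset.sum_involution (fun p _ => ⟨p.2, p.1⟩) ?_ ?_ ?_ ?_
    · rintro ⟨v, w⟩ h
      simp only [Finset.mem_sigma, Finset.mem_erase] at h ⊢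
      obtain ⟨hv, hne, hw⟩ := h
      rw [Finset.erase_right_comm (a := w) (b := v), ← add_smul]
      rcases lt_or_gt_of_ne hne with h | h
      · rw [sign_cancel k s hw h, zero_smul]
      · rw [add_comm, sign_cancel k s hv h, zero_smul]
    · rintro ⟨v, w⟩ h _ heq
      simp only [Finset.mem_sigma, Finset.mem_erase] at h
      simp only [Sigma.mk.injEq] at heq
      exact h.2.1 heq.1
    · rintro ⟨v, w⟩ h
      simp only [Finset.mem_sigma, Finset.mem_erase] at h ⊢
      exact ⟨h.2.2, h.2.1.symm, h.1⟩
    · rintro ⟨v, w⟩ _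
      rfl

/-- Every boundary is a cycle. -/
theorem boundaries_le_cycles (K : PreAbstractSimplicialComplex V) (l : ℤ) :
    boundaries k K l ≤ cycles k K l := by
  rintro _ ⟨x, hx, rfl⟩
  refine ⟨?_, boundary_boundary k x⟩
  have hx' : x ∈ chains k K (l + 1) := hx
  rw [chains, Finsupp.supported_eq_span_single] at hx'
  change boundary k x ∈ chains k K l
  refine Submodule.span_induction (p := fun x _ => boundary k x ∈ chains k K l)
    ?_ (by simp) (fun x y _ _ hx hy => by simpa using add_mem hx hy)
    (fun c x _ hx => by simpa using Submodule.smul_mem _ c hx) hx'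
  rintro _ ⟨s, ⟨hs, hcard⟩, rfl⟩
  rw [boundary_single]
  refine Submodule.sum_mem _ fun v hv => Submodule.smul_mem _ _ ?_
  refine Finsupp.single_mem_supported k _ ⟨?_, ?_⟩
  · rcases Finset.eq_empty_or_nonempty (s.erase v) with h | h
    · exact Or.inl h
    · rcases hs with rfl | hs
      · simp at hv
      · exact Or.inr ((K.isRelLowerSet_faces hs).2 (Finset.erase_subset _ _) h)
  · have := Finset.card_erase_add_one hv
    omega

/-- The reduced simplicial homology `H̃_l(K; k)`: cycles modulo boundaries. -/
abbrev ReducedHomology (K : PreAbstractSimplicialComplex V) (l : ℤ) : Type _ :=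
  Subquotient (cycles k K l) (boundaries k K l)

/-- The set of all `l + 2` such that some induced subcomplex has nonzero reduced homology in
degree `l`. -/
def regularitySet (K : PreAbstractSimplicialComplex V) : Set ℤ :=
  {m | ∃ (W : Set V) (l : ℤ), W ⊆ vertices K ∧
    Nontrivial (ReducedHomology k (induced K W) l) ∧ m = l + 2}

/-- The regularity of `K` over `k`: the largest `l + 2` such that some induced subcomplex has
nonzero reduced homology in degree `l`. The maximum exists, see `isGreatest_regularity`. -/
noncomputable def regularity (K : PreAbstractSimplicialComplex V) : ℤ :=
  sSup (regularitySet k K)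

theorem nontrivial_reducedHomology_iff (K : PreAbstractSimplicialComplex V) (l : ℤ) :
    Nontrivial (ReducedHomology k K l) ↔ ¬ cycles k K l ≤ boundaries k K l :=
  nontrivial_subquotient_iff _ _

/-- For a finite vertex set the maximum defining the regularity exists. -/
theorem isGreatest_regularity [Finite V] (K : PreAbstractSimplicialComplex V) :
    IsGreatest (regularitySet k K) (regularity k K) := by
  have := Fintype.ofFinite V
  have hne : (regularitySet k K).Nonempty := by
    refine ⟨1, ∅, -1, Set.empty_subset _, ?_, by norm_num⟩
    rw [nontrivial_reducedHomology_iff]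
    intro h
    have h1 : (Finsupp.single ∅ 1 : Finset V →₀ k) ∈ cycles k (induced K ∅) (-1) :=
      ⟨Finsupp.single_mem_supported k _ (by simp), by simp [boundary_single]⟩
    obtain ⟨x, hx, hx1⟩ := h h1
    have hx0 : x = 0 := by
      have hx' : x ∈ chains k (induced K ∅) (-1 + 1) := hx
      have he : {s : Finset V | (s = ∅ ∨ s ∈ (induced K ∅).faces) ∧
          (s.card : ℤ) = -1 + 1 + 1} = ∅ := by
        ext s
        simp only [Set.mem_ofPred_eq, Set.mem_empty_iff_false, iff_false]
        rintro ⟨rfl | hs, hc⟩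
        · simp at hc
        · have : s = ∅ := by simpa [Set.subset_empty_iff] using hs.2
          simp [this] at hc
      rw [chains, he, Finsupp.supported_empty] at hx'
      simpa using hx'
    rw [hx0, map_zero] at hx1
    exact one_ne_zero (Finsupp.single_eq_zero.mp hx1.symm)
  have hbdd : BddAbove (regularitySet k K) := by
    refine ⟨Fintype.card V + 1, ?_⟩
    rintro _ ⟨W, l, -, h, rfl⟩
    rw [nontrivial_reducedHomology_iff] at h
    by_contra! hl
    apply h
    intro x hx
    have hx' : x ∈ chains k (induced K W) l := hx.1
    have he : {s : Finset V | (s = ∅ ∨ s ∈ (induced K W).faces) ∧ (s.card : ℤ) = l + 1} = ∅ := by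
      ext s
      have := Finset.card_le_univ s
      simp only [Set.mem_ofPred_eq, Set.mem_empty_iff_false, iff_false, not_and]
      intro _ hc
      omega
    rw [chains, he, Finsupp.supported_empty] at hx'
    rw [(Submodule.mem_bot k).mp hx']
    exact zero_mem _
  exact ⟨Int.csSup_mem hne hbdd, fun m hm => le_csSup hbdd hm⟩

end Homology

/-- The graph `G' = G ∪ {xy : x ≠ y, ax ∈ E(G), by ∈ E(G)}`. -/
def edgeExtension {V : Type*} (G : SimpleGraph V) (a b : V) : SimpleGraph V :=
  G ⊔ SimpleGraph.fromRel fun x y => G.Adj a x ∧ G.Adj b y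

end SimplicialReg

/-! The faces of `cl(Hᶜ)` are the nonempty independent sets of `H`. Suppose `reg Δ < l + 2`; it
suffices that the degree `l` homology of `Δ'[W]` vanishes for every `W`. Write `N(a)`, `N(b)` for
neighbourhoods in `G`.

If `W` misses `N(a)` or `N(b)`, no added edge lies in `W`, so `Δ'[W] = Δ[W]`. If `U` misses both,
then `Δ[U ∪ {a, b}]` is the suspension of `Δ[U]`, because `ab` is an edge; hence `Δ[U]` has no
homology already in degree `l - 1` (`cycles_le_boundaries_of_avoids_edge`).

If `W` contains no common neighbour of `a` and `b`, an independent set of `G'` in `W` cannot meet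
both `N(a)` and `N(b)`. So `Δ'[W]` is the union of `Δ'[W \ N(a)]` and `Δ'[W \ N(b)]`, whose
intersection is of the kind `Δ[U]`, and Mayer–Vietoris applies. A common neighbour `c` is adjacent
in `G'` to everything else in `N(a) ∪ N(b)`, so its link in `Δ'[W]` is again of the kind `Δ[U]`, and
`c` can be deleted by induction on `W`. -/

namespace SimplicialReg

/-! ### Chains and their supports -/

section Chains

variable {k : Type*} [Field k] {V : Type*}

/-- A linear map sends chains to chains if it does so on the simplices. -/
theorem map_mem_of_mem_chains {K : PreAbstractSimplicialComplex V} {l : ℤ}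
    (f : (Finset V →₀ k) →ₗ[k] (Finset V →₀ k)) (N : Submodule k (Finset V →₀ k))
    (h : ∀ s : Finset V, (s = ∅ ∨ s ∈ K.faces) → (s.card : ℤ) = l + 1 →
      f (Finsupp.single s 1) ∈ N) {x : Finset V →₀ k} (hx : x ∈ chains k K l) : f x ∈ N := by
  rw [chains, Finsupp.supported_eq_span_single] at hx
  refine (Submodule.span_le (p := N.comap f)).mpr ?_ hx
  rintro _ ⟨s, ⟨hs, hc⟩, rfl⟩
  exact h s hs hc

theorem single_mem_chains {K : PreAbstractSimplicialComplex V} {l : ℤ} {s : Finset V}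
    (hs : s = ∅ ∨ s ∈ K.faces) (hc : (s.card : ℤ) = l + 1) :
    Finsupp.single s (1 : k) ∈ chains k K l :=
  Finsupp.single_mem_supported k _ ⟨hs, hc⟩

theorem chains_mono {K L : PreAbstractSimplicialComplex V} (h : K.faces ⊆ L.faces) (l : ℤ) :
    chains k K l ≤ chains k L l :=
  Finsupp.supported_mono fun _ hs => ⟨hs.1.imp_right fun h' => h h', hs.2⟩

end Chains

/-! ### Coning and contraction as operators on chains -/

section ChainMaps

variable (k : Type*) [Field k] {V : Type*} [LinearOrder V]

/-- Coning with apex `a`, on the free module spanned by all finite sets of vertices. -/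
noncomputable def coneMap (a : V) : (Finset V →₀ k) →ₗ[k] (Finset V →₀ k) :=
  Finsupp.linearCombination k fun s : Finset V =>
    if a ∈ s then 0 else sign k s a • Finsupp.single (insert a s) (1 : k)

/-- The map to the link of `a`: the contraction of a simplex along its vertex `a`. -/
noncomputable def linkMap (a : V) : (Finset V →₀ k) →ₗ[k] (Finset V →₀ k) :=
  Finsupp.linearCombination k fun s : Finset V =>
    if a ∈ s then sign k s a • Finsupp.single (s.erase a) (1 : k) else 0

theorem coneMap_single (a : V) (s : Finset V) : coneMap k a (Finsupp.single s 1) =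
    if a ∈ s then 0 else sign k s a • Finsupp.single (insert a s) (1 : k) := by
  simp [coneMap]

theorem linkMap_single (a : V) (s : Finset V) : linkMap k a (Finsupp.single s 1) =
    if a ∈ s then sign k s a • Finsupp.single (s.erase a) (1 : k) else 0 := by
  simp [linkMap]

theorem sign_mul_self (s : Finset V) (v : V) : sign k s v * sign k s v = 1 := by
  rw [sign, ← mul_pow]
  simp

theorem sign_insert_self (s : Finset V) (v : V) : sign k (insert v s) v = sign k s v := by
  simp [sign, Finset.filter_insert]

theorem sign_erase_self (s : Finset V) (v : V) : sign k (s.erase v) v = sign k s v := by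
  rw [sign, sign, Finset.filter_erase, Finset.erase_eq_of_notMem (by simp)]

theorem sign_anticomm (s : Finset V) {v w : V} (hv : v ∈ s) (hw : w ∈ s) (hne : v ≠ w) :
    sign k s v * sign k (s.erase v) w + sign k s w * sign k (s.erase w) v = 0 := by
  rcases lt_or_gt_of_ne hne with h | h
  · rw [add_comm, sign_cancel k s hv h]
  · exact sign_cancel k s hw h

/-- This is `sign_anticomm` for `insert a s`, multiplied by two signs that square to one. -/
theorem sign_insert_anticomm (s : Finset V) {a v : V} (ha : a ∉ s) (hv : v ∈ s) :
    sign k s a * sign k (insert a s) v + sign k s v * sign k (s.erase v) a = 0 := by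
  have hne : v ≠ a := fun h => ha (h ▸ hv)
  have h := sign_anticomm k (insert a s) (Finset.mem_insert_of_mem hv)
    (Finset.mem_insert_self a s) hne
  rw [Finset.erase_insert_of_ne hne.symm, Finset.erase_insert ha, sign_insert_self,
    sign_insert_self] at h
  have h1 := sign_mul_self k s a
  have h2 := sign_mul_self k (s.erase v) a
  linear_combination (sign k s a * sign k (s.erase v) a) * h -
    (sign k s a * sign k (insert a s) v) * h2 - (sign k s v * sign k (s.erase v) a) * h1

/-- Coning is a contracting homotopy: removing the apex gives back the simplex, and the faces that
keep the apex cancel in pairs. -/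
theorem boundary_coneMap (a : V) (x : Finset V →₀ k) :
    boundary k (coneMap k a x) + coneMap k a (boundary k x) = x := by
  suffices h : boundary k ∘ₗ coneMap k a + coneMap k a ∘ₗ boundary k = LinearMap.id from
    LinearMap.congr_fun h x
  refine Finsupp.lhom_ext' fun s => LinearMap.ext_ring ?_
  simp only [LinearMap.comp_apply, LinearMap.add_apply, Finsupp.lsingle_apply, LinearMap.id_apply,
    coneMap_single, boundary_single, map_sum, map_smul]
  by_cases ha : a ∈ s
  · rw [if_pos ha, map_zero, zero_add, Finset.sum_eq_single a]
    · rw [if_neg (Finset.notMem_erase a s), sign_erase_self, smul_smul, sign_mul_self, one_smul,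
        Finset.insert_erase ha]
    · intro v _ hva
      rw [if_pos (Finset.mem_erase.mpr ⟨hva.symm, ha⟩), smul_zero]
    · exact fun h => absurd ha h
  · rw [if_neg ha, map_smul, boundary_single, Finset.sum_insert ha, smul_add, smul_smul,
      sign_insert_self, sign_mul_self, one_smul, Finset.erase_insert ha, add_assoc,
      add_eq_left, Finset.smul_sum, ← Finset.sum_add_distrib]
    refine Finset.sum_eq_zero fun v hv => ?_
    have hne : v ≠ a := fun h => ha (h ▸ hv)
    rw [if_neg (fun h => ha (Finset.mem_of_mem_erase h)), Finset.erase_insert_of_ne hne.symm,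
      smul_smul, smul_smul, ← add_smul, sign_insert_anticomm k s ha hv, zero_smul]

/-- Removing `a` and another vertex in the two possible orders gives opposite signs. -/
theorem boundary_linkMap (a : V) (x : Finset V →₀ k) :
    boundary k (linkMap k a x) + linkMap k a (boundary k x) = 0 := by
  suffices h : boundary k ∘ₗ linkMap k a + linkMap k a ∘ₗ boundary k = 0 from
    LinearMap.congr_fun h x
  refine Finsupp.lhom_ext' fun s => LinearMap.ext_ring ?_
  simp only [LinearMap.comp_apply, LinearMap.add_apply, Finsupp.lsingle_apply,
    LinearMap.zero_apply, linkMap_single, boundary_single, map_sum, map_smul]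
  by_cases ha : a ∈ s
  · rw [if_pos ha, map_smul, boundary_single, ← Finset.add_sum_erase s _ ha,
      if_neg (Finset.notMem_erase a s), smul_zero, zero_add, Finset.smul_sum,
      ← Finset.sum_add_distrib]
    refine Finset.sum_eq_zero fun v hv => ?_
    obtain ⟨hva, hvs⟩ := Finset.mem_erase.mp hv
    rw [if_pos (Finset.mem_erase.mpr ⟨hva.symm, ha⟩), Finset.erase_right_comm, smul_smul,
      smul_smul, ← add_smul, sign_anticomm k s ha hvs hva.symm, zero_smul]
  · rw [if_neg ha, map_zero, zero_add]
    refine Finset.sum_eq_zero fun v _ => ?_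
    rw [if_neg (fun h => ha (Finset.mem_of_mem_erase h)), smul_zero]

theorem linkMap_coneMap_self (a : V) {x : Finset V →₀ k}
    (hx : x ∈ Finsupp.supported k k {s : Finset V | a ∉ s}) :
    linkMap k a (coneMap k a x) = x := by
  rw [Finsupp.supported_eq_span_single] at hx
  refine LinearMap.eqOn_span (f := linkMap k a ∘ₗ coneMap k a) (g := LinearMap.id) ?_ hx
  rintro _ ⟨s, hs, rfl⟩
  rw [LinearMap.comp_apply, coneMap_single, if_neg hs, map_smul, linkMap_single,
    if_pos (Finset.mem_insert_self a s), Finset.erase_insert hs, sign_insert_self, smul_smul,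
    sign_mul_self, one_smul, LinearMap.id_apply]

theorem linkMap_coneMap_of_ne {a b : V} (hab : a ≠ b) {x : Finset V →₀ k}
    (hx : x ∈ Finsupp.supported k k {s : Finset V | a ∉ s}) :
    linkMap k a (coneMap k b x) = 0 := by
  rw [Finsupp.supported_eq_span_single] at hx
  refine LinearMap.eqOn_span (f := linkMap k a ∘ₗ coneMap k b) (g := 0) ?_ hx
  rintro _ ⟨s, hs, rfl⟩
  rw [LinearMap.comp_apply, coneMap_single, LinearMap.zero_apply]
  split_ifs with hb
  · rw [map_zero]
  · rw [map_smul, linkMap_single, if_neg (by simpa [hab] using hs), smul_zero]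

variable {k}

theorem coneMap_mem_chains {K L : PreAbstractSimplicialComplex V} {a : V} {l m : ℤ}
    (hm : m = l + 1) (h : ∀ s : Finset V, (s = ∅ ∨ s ∈ K.faces) → insert a s ∈ L.faces)
    {x : Finset V →₀ k} (hx : x ∈ chains k K l) : coneMap k a x ∈ chains k L m := by
  refine map_mem_of_mem_chains _ _ (fun s hs hc => ?_) hx
  rw [coneMap_single]
  split_ifs with ha
  · exact zero_mem _
  · refine Submodule.smul_mem _ _ (single_mem_chains (Or.inr (h s hs)) ?_)
    rw [Finset.card_insert_of_notMem ha]
    push_cast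
    omega

theorem linkMap_mem_chains {K L : PreAbstractSimplicialComplex V} {a : V} {l m : ℤ}
    (hm : l = m + 1)
    (h : ∀ s ∈ K.faces, a ∈ s → (s.erase a).Nonempty → s.erase a ∈ L.faces)
    {x : Finset V →₀ k} (hx : x ∈ chains k K l) : linkMap k a x ∈ chains k L m := by
  refine map_mem_of_mem_chains _ _ (fun s hs hc => ?_) hx
  rw [linkMap_single]
  split_ifs with ha
  · refine Submodule.smul_mem _ _ (single_mem_chains ?_ ?_)
    · rcases (s.erase a).eq_empty_or_nonempty with he | he
      · exact Or.inl he
      · refine Or.inr (h s (hs.resolve_left ?_) ha he)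
        rintro rfl
        simp at ha
    · have := Finset.card_erase_add_one ha
      omega
  · exact zero_mem _

theorem boundary_mem_chains {K : PreAbstractSimplicialComplex V} {l : ℤ} {x : Finset V →₀ k}
    (hx : x ∈ chains k K (l + 1)) : boundary k x ∈ chains k K l :=
  (boundaries_le_cycles k K l ⟨x, hx, rfl⟩).1

end ChainMaps

/-! ### Cones, unions and suspensions -/

section Acyclicity

variable {k : Type*} [Field k] {V : Type*} [LinearOrder V]

/-- A cone has no reduced homology. -/
theorem cycles_le_boundaries_of_cone {K : PreAbstractSimplicialComplex V} (a : V)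
    (h : ∀ s : Finset V, (s = ∅ ∨ s ∈ K.faces) → insert a s ∈ K.faces) (l : ℤ) :
    cycles k K l ≤ boundaries k K l := by
  rintro z ⟨hz, hz0⟩
  refine ⟨coneMap k a z, coneMap_mem_chains rfl h hz, ?_⟩
  have := boundary_coneMap k a z
  rwa [LinearMap.mem_ker.mp hz0, map_zero, add_zero] at this

/-- The part of the Mayer–Vietoris sequence that bounds the homology of a union. -/
theorem cycles_le_boundaries_of_union {K K₁ K₂ M : PreAbstractSimplicialComplex V}
    (hK : ∀ s ∈ K.faces, s ∈ K₁.faces ∨ s ∈ K₂.faces) (h₁ : K₁.faces ⊆ K.faces)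
    (h₂ : K₂.faces ⊆ K.faces) (hM : M.faces = K₁.faces ∩ K₂.faces) {l : ℤ}
    (a₁ : cycles k K₁ l ≤ boundaries k K₁ l) (a₂ : cycles k K₂ l ≤ boundaries k K₂ l)
    (aM : cycles k M (l - 1) ≤ boundaries k M (l - 1)) :
    cycles k K l ≤ boundaries k K l := by
  rintro z ⟨hz, hz0⟩
  have hsplit : chains k K l ≤ chains k K₁ l ⊔ chains k K₂ l := by
    rw [chains, chains, chains, ← Finsupp.supported_union]
    refine Finsupp.supported_mono fun s hs => ?_
    rcases hs.1 with h | h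
    · exact Or.inl ⟨Or.inl h, hs.2⟩
    · exact (hK s h).imp (fun h' => ⟨Or.inr h', hs.2⟩) (fun h' => ⟨Or.inr h', hs.2⟩)
  obtain ⟨x, hx, y, hy, rfl⟩ := Submodule.mem_sup.mp (hsplit hz)
  replace hz0 : boundary k x + boundary k y = 0 := by
    rw [← map_add]
    exact LinearMap.mem_ker.mp hz0
  have hinter : chains k K₁ (l - 1) ⊓ chains k K₂ (l - 1) ≤ chains k M (l - 1) := by
    rw [chains, chains, chains, ← Finsupp.supported_inter]
    refine Finsupp.supported_mono fun s hs => ⟨?_, hs.1.2⟩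
    rcases hs.1.1 with h | h
    · exact Or.inl h
    · rcases hs.2.1 with h' | h'
      · exact Or.inl h'
      · exact Or.inr (hM ▸ ⟨h, h'⟩)
  have hl : l = l - 1 + 1 := by ring
  have hbx : boundary k x ∈ chains k K₁ (l - 1) := boundary_mem_chains (hl ▸ hx)
  have hby : boundary k x ∈ chains k K₂ (l - 1) := by
    rw [eq_neg_of_add_eq_zero_left hz0]
    exact neg_mem (boundary_mem_chains (hl ▸ hy))
  -- `∂x = -∂y` is a cycle of the intersection; a chain `w` bounding it there corrects `x` and `y`
  -- to cycles `x - w` and `y + w`.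
  obtain ⟨w, hw, hwx⟩ := aM ⟨hinter ⟨hbx, hby⟩, boundary_boundary k x⟩
  have hw' : w ∈ chains k M l := by rw [hl]; exact hw
  obtain ⟨u, hu, hu'⟩ := a₁ (x := x - w)
    ⟨sub_mem hx (chains_mono (hM ▸ Set.inter_subset_left) l hw'), by
      rw [SetLike.mem_coe, LinearMap.mem_ker, map_sub, hwx, sub_self]⟩
  obtain ⟨v, hv, hv'⟩ := a₂ (x := y + w)
    ⟨add_mem hy (chains_mono (hM ▸ Set.inter_subset_right) l hw'), by
      rw [SetLike.mem_coe, LinearMap.mem_ker, map_add, hwx, add_comm, hz0]⟩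
  refine ⟨u + v, add_mem (chains_mono h₁ _ hu) (chains_mono h₂ _ hv), ?_⟩
  rw [map_add, hu', hv']
  abel

/-- If `L` contains the suspension of `K` with apices `a` and `b`, and `K` is the whole link of
`a` in `L`, then a vanishing homology of `L` makes that of `K` vanish one degree lower. -/
theorem cycles_le_boundaries_of_suspension {K L : PreAbstractSimplicialComplex V} {a b : V}
    (hab : a ≠ b) (haK : ∀ s ∈ K.faces, a ∉ s)
    (ha : ∀ s : Finset V, (s = ∅ ∨ s ∈ K.faces) → insert a s ∈ L.faces)
    (hb : ∀ s : Finset V, (s = ∅ ∨ s ∈ K.faces) → insert b s ∈ L.faces)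
    (hlink : ∀ s ∈ L.faces, a ∈ s → (s.erase a).Nonempty → s.erase a ∈ K.faces) {l : ℤ}
    (h : cycles k L (l + 1) ≤ boundaries k L (l + 1)) :
    cycles k K l ≤ boundaries k K l := by
  rintro z ⟨hz, hz0⟩
  have hza : z ∈ Finsupp.supported k k {s : Finset V | a ∉ s} := by
    refine Finsupp.supported_mono (fun s hs => ?_) hz
    rcases hs.1 with rfl | h
    · simp
    · exact haK s h
  have hcone : ∀ c : V, boundary k (coneMap k c z) = z := fun c => by
    have := boundary_coneMap k c z
    rwa [LinearMap.mem_ker.mp hz0, map_zero, add_zero] at this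
  -- The suspension of `z` is a cycle of `L`. Contracting it along `a` recovers `z`, so contracting
  -- a chain `u` that it bounds gives, up to sign, a chain of `K` bounded by `z`.
  obtain ⟨u, hu, hu'⟩ := h (x := coneMap k a z - coneMap k b z)
    ⟨sub_mem (coneMap_mem_chains rfl ha hz) (coneMap_mem_chains rfl hb hz), by
      rw [SetLike.mem_coe, LinearMap.mem_ker, map_sub, hcone, hcone, sub_self]⟩
  have key := boundary_linkMap k a u
  rw [hu', map_sub, linkMap_coneMap_self k a hza, linkMap_coneMap_of_ne k hab hza, sub_zero]
    at key
  refine ⟨-linkMap k a u, neg_mem (linkMap_mem_chains rfl hlink hu), ?_⟩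
  rw [map_neg, eq_neg_of_add_eq_zero_left key, neg_neg]

end Acyclicity

/-! ### Independence complexes and the edge extension -/

section IndependenceComplex

variable {V : Type*}

theorem vertices_cliqueComplex (G : SimpleGraph V) : vertices (cliqueComplex G) = Set.univ := by
  ext v
  simp [vertices, cliqueComplex]

theorem mem_faces_induced_compl {H : SimpleGraph V} {W : Set V} {s : Finset V} :
    s ∈ (induced (cliqueComplex Hᶜ) W).faces ↔
      s.Nonempty ∧ (∀ x ∈ s, ∀ y ∈ s, ¬ H.Adj x y) ∧ ∀ x ∈ s, x ∈ W := by
  change (s.Nonempty ∧ Hᶜ.IsClique (s : Set V)) ∧ (s : Set V) ⊆ W ↔ _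
  rw [and_assoc]
  refine and_congr Iff.rfl (and_congr ⟨fun h x hx y hy hxy => ?_, fun h x hx y hy hne => ?_⟩
    Iff.rfl)
  · exact (h hx hy hxy.ne).2 hxy
  · exact ⟨hne, h x hx y hy⟩

theorem edgeExtension_adj {G : SimpleGraph V} {a b x y : V} :
    (edgeExtension G a b).Adj x y ↔
      G.Adj x y ∨ x ≠ y ∧ (G.Adj a x ∧ G.Adj b y ∨ G.Adj a y ∧ G.Adj b x) := by
  simp [edgeExtension]

/-- Away from the neighbours of `a`, or from those of `b`, the edge extension changes nothing. -/
theorem induced_edgeExtension_eq {G : SimpleGraph V} {a b : V} {W : Set V}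
    (hW : (∀ x ∈ W, ¬ G.Adj a x) ∨ ∀ x ∈ W, ¬ G.Adj b x) :
    induced (cliqueComplex (edgeExtension G a b)ᶜ) W = induced (cliqueComplex Gᶜ) W := by
  ext s
  simp only [mem_faces_induced_compl, edgeExtension_adj]
  refine and_congr_right fun _ => and_congr_left fun hs => ?_
  refine forall₂_congr fun x hx => forall₂_congr fun y hy => not_congr ?_
  rcases hW with h | h
  · simp [h x (hs x hx), h y (hs y hy)]
  · simp [h x (hs x hx), h y (hs y hy)]

variable {k : Type*} [Field k] [LinearOrder V]

theorem cycles_le_boundaries_of_regularity_lt [Finite V] (G : SimpleGraph V) (W : Set V) {l : ℤ}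
    (hl : regularity k (cliqueComplex G) < l + 2) :
    cycles k (induced (cliqueComplex G) W) l ≤ boundaries k (induced (cliqueComplex G) W) l := by
  by_contra h
  refine hl.not_ge ((isGreatest_regularity k _).2 ⟨W, l, ?_, ?_, rfl⟩)
  · simp [vertices_cliqueComplex]
  · rwa [nontrivial_reducedHomology_iff]

/-- Deleting a vertex `c` from an independence complex. -/
theorem cycles_le_boundaries_of_deletion {H : SimpleGraph V} {W : Set V} {c : V} (hc : c ∈ W)
    {l : ℤ}
    (hdel : cycles k (induced (cliqueComplex Hᶜ) (W \ {c})) l ≤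
      boundaries k (induced (cliqueComplex Hᶜ) (W \ {c})) l)
    (hlink : cycles k (induced (cliqueComplex Hᶜ) {x ∈ W | x ≠ c ∧ ¬ H.Adj c x}) (l - 1) ≤
      boundaries k (induced (cliqueComplex Hᶜ) {x ∈ W | x ≠ c ∧ ¬ H.Adj c x}) (l - 1)) :
    cycles k (induced (cliqueComplex Hᶜ) W) l ≤ boundaries k (induced (cliqueComplex Hᶜ) W) l := by
  -- `K₂` is the star of `c`, a cone; it meets the deletion of `c` in the link of `c`.
  refine cycles_le_boundaries_of_union (K₂ := induced (cliqueComplex Hᶜ) {x ∈ W | ¬ H.Adj c x})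
    (fun s hs => ?_) (fun s hs => ?_) (fun s hs => ?_) ?_ hdel
    (cycles_le_boundaries_of_cone c (fun s hs => ?_) l) hlink
  · rw [mem_faces_induced_compl] at hs
    simp only [mem_faces_induced_compl]
    by_cases hcs : c ∈ s
    · exact Or.inr ⟨hs.1, hs.2.1, fun x hx => ⟨hs.2.2 x hx, hs.2.1 c hcs x hx⟩⟩
    · exact Or.inl ⟨hs.1, hs.2.1, fun x hx => ⟨hs.2.2 x hx, fun h => hcs (h ▸ hx)⟩⟩
  · rw [mem_faces_induced_compl] at hs ⊢
    exact ⟨hs.1, hs.2.1, fun x hx => (hs.2.2 x hx).1⟩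
  · rw [mem_faces_induced_compl] at hs ⊢
    exact ⟨hs.1, hs.2.1, fun x hx => (hs.2.2 x hx).1⟩
  · ext s
    simp only [Set.mem_inter_iff, mem_faces_induced_compl, Set.mem_sep_iff, Set.mem_sdiff,
      Set.mem_singleton_iff]
    grind
  · rw [mem_faces_induced_compl]
    refine ⟨Finset.insert_nonempty c s, ?_⟩
    rcases hs with rfl | hs
    · simp [hc]
    · rw [mem_faces_induced_compl] at hs
      obtain ⟨-, hs, hsW⟩ := hs
      simp only [Finset.forall_mem_insert, Set.mem_sep_iff, SimpleGraph.irrefl, not_false_eq_true,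
        true_and, and_true]
      exact ⟨⟨fun x hx => (hsW x hx).2,
        fun x hx => ⟨fun h => (hsW x hx).2 h.symm, hs x hx⟩⟩, hc, hsW⟩

/-- On a set of vertices away from the neighbours of the ends of an edge, the homology of an
independence complex vanishes one degree earlier, since its suspension is induced as well. -/
theorem cycles_le_boundaries_of_avoids_edge [Finite V] {G : SimpleGraph V} {a b : V}
    (hab : G.Adj a b) {U : Set V} (hU : ∀ x ∈ U, ¬ G.Adj a x ∧ ¬ G.Adj b x) {l : ℤ}
    (hl : regularity k (cliqueComplex Gᶜ) < l + 3) :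
    cycles k (induced (cliqueComplex Gᶜ) U) l ≤ boundaries k (induced (cliqueComplex Gᶜ) U) l := by
  have haU : a ∉ U := fun h => (hU a h).2 hab.symm
  have hinsert : ∀ c ∈ ({a, b} : Set V), ∀ s : Finset V,
      (s = ∅ ∨ s ∈ (induced (cliqueComplex Gᶜ) U).faces) →
        insert c s ∈ (induced (cliqueComplex Gᶜ) (U ∪ {a, b})).faces := by
    intro c hc s hs
    rw [mem_faces_induced_compl]
    refine ⟨Finset.insert_nonempty c s, ?_⟩
    rcases hs with rfl | hs
    · simpa [or_assoc] using Or.inl (b := c ∈ U) hc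
    · rw [mem_faces_induced_compl] at hs
      obtain ⟨-, hs, hsU⟩ := hs
      have hcU : ∀ x ∈ s, ¬ G.Adj c x := fun x hx => by
        rcases hc with rfl | rfl
        · exact (hU x (hsU x hx)).1
        · exact (hU x (hsU x hx)).2
      simp only [Finset.forall_mem_insert, SimpleGraph.irrefl, not_false_eq_true, true_and]
      exact ⟨⟨hcU, fun x hx => ⟨fun h => hcU x hx h.symm, hs x hx⟩⟩, Or.inr hc,
        fun x hx => Or.inl (hsU x hx)⟩
  refine cycles_le_boundaries_of_suspension (L := induced (cliqueComplex Gᶜ) (U ∪ {a, b}))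
    hab.ne (fun s hs has => ?_) (hinsert a (by simp)) (hinsert b (by simp))
    (fun s hs has hne => ?_) (cycles_le_boundaries_of_regularity_lt _ _ (by linarith))
  · exact haU ((mem_faces_induced_compl.mp hs).2.2 a has)
  · rw [mem_faces_induced_compl] at hs ⊢
    refine ⟨hne, fun x hx y hy => hs.2.1 x (Finset.mem_of_mem_erase hx) y
      (Finset.mem_of_mem_erase hy), fun x hx => ?_⟩
    obtain ⟨hxa, hxs⟩ := Finset.mem_erase.mp hx
    rcases hs.2.2 x hxs with h | rfl | rfl
    · exact h
    · exact absurd rfl hxa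
    -- A face through `a` cannot contain `b`, so the link of `a` stays inside `U`.
    · exact absurd hab (hs.2.1 a has x hxs)

theorem cycles_le_boundaries_edgeExtension [Finite V] {G : SimpleGraph V} {a b : V}
    (hab : G.Adj a b) {l : ℤ} (hl : regularity k (cliqueComplex Gᶜ) < l + 2) (W : Set V) :
    cycles k (induced (cliqueComplex (edgeExtension G a b)ᶜ) W) l ≤
      boundaries k (induced (cliqueComplex (edgeExtension G a b)ᶜ) W) l := by
  have havoid : ∀ U : Set V, (∀ x ∈ U, ¬ G.Adj a x ∧ ¬ G.Adj b x) →
      cycles k (induced (cliqueComplex (edgeExtension G a b)ᶜ) U) (l - 1) ≤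
        boundaries k (induced (cliqueComplex (edgeExtension G a b)ᶜ) U) (l - 1) := by
    intro U hU
    rw [induced_edgeExtension_eq (Or.inl fun x hx => (hU x hx).1)]
    exact cycles_le_boundaries_of_avoids_edge hab hU (by linarith)
  induction W using WellFoundedLT.induction with
  | ind W ih =>
  by_cases hW : ∃ c ∈ W, G.Adj a c ∧ G.Adj b c
  · obtain ⟨c, hcW, hac, hbc⟩ := hW
    refine cycles_le_boundaries_of_deletion hcW (ih _ (Set.sdiff_singleton_ssubset.mpr hcW))
      (havoid _ fun x hx => ?_)
    obtain ⟨-, hxc, hx⟩ := hx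
    rw [edgeExtension_adj] at hx
    -- A neighbour of `a` is joined to `c` through the edge `bc`, a neighbour of `b` through `ac`.
    exact ⟨fun h => hx (Or.inr ⟨hxc.symm, Or.inr ⟨h, hbc⟩⟩),
      fun h => hx (Or.inr ⟨hxc.symm, Or.inl ⟨hac, h⟩⟩)⟩
  · push Not at hW
    refine cycles_le_boundaries_of_union
      (K₁ := induced (cliqueComplex (edgeExtension G a b)ᶜ) {x ∈ W | ¬ G.Adj a x})
      (K₂ := induced (cliqueComplex (edgeExtension G a b)ᶜ) {x ∈ W | ¬ G.Adj b x})
      (M := induced (cliqueComplex (edgeExtension G a b)ᶜ)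
        {x ∈ W | ¬ G.Adj a x ∧ ¬ G.Adj b x})
      (fun s hs => ?_) (fun s hs => ?_) (fun s hs => ?_) ?_ ?_ ?_ (havoid _ fun x hx => hx.2)
    · rw [mem_faces_induced_compl] at hs
      simp only [mem_faces_induced_compl]
      by_cases has : ∃ x ∈ s, G.Adj a x
      · obtain ⟨x, hx, hax⟩ := has
        -- The vertices `x ∈ N(a)` and `y ∈ N(b)` are distinct, as `W` has no common neighbour,
        -- hence adjacent in `G'`.
        refine Or.inr ⟨hs.1, hs.2.1, fun y hy => ⟨hs.2.2 y hy, fun hby => hs.2.1 x hx y hy ?_⟩⟩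
        rw [edgeExtension_adj]
        refine Or.inr ⟨?_, Or.inl ⟨hax, hby⟩⟩
        rintro rfl
        exact hW x (hs.2.2 x hx) hax hby
      · exact Or.inl ⟨hs.1, hs.2.1, fun x hx => ⟨hs.2.2 x hx, fun hax => has ⟨x, hx, hax⟩⟩⟩
    · exact ⟨hs.1, fun x hx => (hs.2 hx).1⟩
    · exact ⟨hs.1, fun x hx => (hs.2 hx).1⟩
    · ext s
      simp only [Set.mem_inter_iff, mem_faces_induced_compl, Set.mem_sep_iff]
      grind
    · rw [induced_edgeExtension_eq (Or.inl fun x hx => hx.2)]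
      exact cycles_le_boundaries_of_regularity_lt _ _ hl
    · rw [induced_edgeExtension_eq (Or.inr fun x hx => hx.2)]
      exact cycles_le_boundaries_of_regularity_lt _ _ hl

end IndependenceComplex

end SimplicialReg

theorem theorem3p1 (k : Type*) [Field k] {V : Type*} [Finite V] [LinearOrder V]
    (G : SimpleGraph V) (a b : V) (hab : G.Adj a b) :
    SimplicialReg.regularity k
        (SimplicialReg.cliqueComplex (SimplicialReg.edgeExtension G a b)ᶜ) ≤
      SimplicialReg.regularity k (SimplicialReg.cliqueComplex Gᶜ) := by
  obtain ⟨W, l, -, hnt, heq⟩ := (SimplicialReg.isGreatest_regularity k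
    (SimplicialReg.cliqueComplex (SimplicialReg.edgeExtension G a b)ᶜ)).1
  rw [heq]
  by_contra! hl
  rw [SimplicialReg.nontrivial_reducedHomology_iff] at hnt
  exact hnt (SimplicialReg.cycles_le_boundaries_edgeExtension hab hl W)
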